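/- Let $n\ge 1$ and let $\mathcal B_n=\{0,1\}^n$ be the Boolean lattice with the componentwise order, least element $\mathbf 0$ and greatest element $\mathbf 1$; for $v\in\mathcal B_n$ let $\sim v$ be the complementary vector. All homology is with rational coefficients. For a subset $P\subseteq\mathcal B_n$ let $\Sigma(P)$ be its order complex (the simplicial complex with one $k$-simplex for each chain $x_0<\dots<x_k$ in $P$); $\Sigma(\mathcal B_n)$ is realized as a triangulation of the cube $[0,1]^n$. For a Boolean function $f:\mathcal B_n\to\{0,1\}$ put $\Sigma(f)=\Sigma(f^{-1}(1))$. For $v\in\mathcal B_n$ let $R_v$ be the union of those facets (codimension one faces) of $[0,1]^n$ that contain $v$, and define $$\beta(f)=\sum_{v\in\mathcal B_n}\ \sum_{i\ge 0}\operatorname{rank} H_i\bigl(\Sigma(f),\,R_v\cap\Sigma(f)\bigr).$$ Let $\Gamma_v(f)$ be the order complex of $\{x\in\mathcal B_n : f(x)=1,\ x\not\le\ \sim v,\ x\not\ge\ \sim v\}$, that is, of the $x$ with $f(x)=1$, $x\wedge v\ne\mathbf 0$ and $x\vee v\ne\mathbf 1$. Let $\tilde b^*(X)=\sum_{i\ge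 -1}\operatorname{rank}\tilde H_i(X)$ be the sum of the Betti numbers of the reduced homology of $X$, with the convention $\tilde H_{-1}(\emptyset)=\mathbb Q$. If $f(\mathbf 0)=f(\mathbf 1)=1$, then $$\beta(f)=\sum_{v\in\mathcal B_n,\ v\ne\mathbf 0,\mathbf 1}\tilde b^*(\Gamma_v(f)).$$ -/

import Mathlib

noncomputable section

/-! ### Simplicial homology of complexes of chains in a poset -/

/-- The order complex of a subset `P` of a partially ordered set `V`: its simplices are the
nonempty finite chains of elements of `P`. -/
def orderComplex {V : Type*} [PartialOrder V] (P : Set V) : PreAbstractSimplicialComplex V where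
  faces := {s | s.Nonempty ∧ IsChain (· ≤ ·) (s : Set V) ∧ ∀ x ∈ s, x ∈ P}
  isRelLowerSet_faces := fun _ hs =>
    ⟨hs.1, fun _ hts ht =>
      ⟨ht, hs.2.1.mono (Finset.coe_subset.2 hts), fun x hx => hs.2.2 x (hts hx)⟩⟩

/-- Formal rational combinations of the chains `x₀ < ⋯ < x_{m-1}` with `m` elements of the
poset `V`. -/
abbrev ChainSpace (V : Type*) [PartialOrder V] (m : ℕ) : Type _ := (Fin m ↪o V) →₀ ℚ

/-- The boundary map `(x₀ < ⋯ < x_m) ↦ ∑ᵢ (-1)ⁱ (x₀ < ⋯ < x̂ᵢ < ⋯ < x_m)`.  For `m = 0` it sends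
every vertex to the empty chain, i.e. it is the augmentation. -/
def boundaryMap (V : Type*) [PartialOrder V] (m : ℕ) :
    ChainSpace V (m + 1) →ₗ[ℚ] ChainSpace V m :=
  Finsupp.linearCombination ℚ fun σ =>
    ∑ i : Fin (m + 1), Finsupp.single ((Fin.succAboveOrderEmb i).trans σ) ((-1 : ℚ) ^ (i : ℕ))

/-- The augmented simplicial chains, in degree `m - 1`, of a simplicial complex `K` whose simplices
are chains of the poset `V`: the span of the simplices of `K` with `m` vertices, together with the
empty simplex if `m = 0`. -/
def simplicialChains {V : Type*} [PartialOrder V] (K : PreAbstractSimplicialComplex V) (m : ℕ) :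
    Submodule ℚ (ChainSpace V m) :=
  Finsupp.supported ℚ ℚ {σ | m = 0 ∨ Finset.univ.map σ.toEmbedding ∈ K}

/-- The relative `k`-cycles of a pair `L ⊆ K`: the `k`-chains of `K` whose boundary is a chain
of `L`.  For `k = 0` the condition on the boundary is void, the empty simplex being
a simplex of `L`. -/
def relativeCycles {V : Type*} [PartialOrder V] (K L : PreAbstractSimplicialComplex V) (k : ℕ) :
    Submodule ℚ (ChainSpace V (k + 1)) :=
  simplicialChains K (k + 1) ⊓ (simplicialChains L k).comap (boundaryMap V k)

/-- The relative `k`-boundaries of a pair `L ⊆ K`: boundaries of `(k+1)`-chains of `K`, up to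
`k`-chains of `L`. -/
def relativeBoundaries {V : Type*} [PartialOrder V] (K L : PreAbstractSimplicialComplex V) (k : ℕ) :
    Submodule ℚ (ChainSpace V (k + 1)) :=
  (simplicialChains K (k + 2)).map (boundaryMap V (k + 1)) ⊔ simplicialChains L (k + 1)

/-- `rank H_k(K, L; ℚ)`, for a pair `L ⊆ K`. -/
def relativeBetti {V : Type*} [PartialOrder V] (K L : PreAbstractSimplicialComplex V) (k : ℕ) : ℕ :=
  Module.finrank ℚ
    (relativeCycles K L k ⧸ (relativeBoundaries K L k).submoduleOf (relativeCycles K L k))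

/-- `b^*(K, L)`, the sum of `rank H_k(K, L; ℚ)` over all `k ≥ 0`.  There are no nonzero `k`-chains
for `k ≥ |V|`. -/
def relativeBettiSum {V : Type*} [PartialOrder V] [Fintype V]
    (K L : PreAbstractSimplicialComplex V) : ℕ :=
  ∑ k ∈ Finset.range (Fintype.card V), relativeBetti K L k

/-- The cycles of the augmented chain complex of `K`, in degree `m - 1`. -/
def reducedCycles {V : Type*} [PartialOrder V] (K : PreAbstractSimplicialComplex V) :
    (m : ℕ) → Submodule ℚ (ChainSpace V m)
  | 0 => simplicialChains K 0
  | m + 1 => simplicialChains K (m + 1) ⊓ LinearMap.ker (boundaryMap V m)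

/-- The boundaries of the augmented chain complex of `K`, in degree `m - 1`. -/
def reducedBoundaries {V : Type*} [PartialOrder V] (K : PreAbstractSimplicialComplex V) (m : ℕ) :
    Submodule ℚ (ChainSpace V m) :=
  (simplicialChains K (m + 1)).map (boundaryMap V m)

/-- The rank of the reduced homology group of `K` in degree `m - 1`, with rational coefficients.
For `m = 0` it is `1` if `K` is empty, and `0` otherwise. -/
def reducedBetti {V : Type*} [PartialOrder V] (K : PreAbstractSimplicialComplex V) (m : ℕ) : ℕ :=
  Module.finrank ℚ (reducedCycles K m ⧸ (reducedBoundaries K m).submoduleOf (reducedCycles K m))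

/-- The sum of the reduced Betti numbers of `K` over all degrees `m - 1 ≥ -1`.  There are no nonzero
chains for `m > |V|`. -/
def reducedBettiSum {V : Type*} [PartialOrder V] [Fintype V]
    (K : PreAbstractSimplicialComplex V) : ℕ :=
  ∑ m ∈ Finset.range (Fintype.card V + 1), reducedBetti K m

/-! ### The red corner model of a Boolean function -/

/-- `Σ(f)`: the order complex of `f⁻¹(1)`. -/
def booleanComplex {n : ℕ} (f : (Fin n → Bool) → Bool) : PreAbstractSimplicialComplex (Fin n → Bool) :=
  orderComplex {x | f x = true}

/-- The vertex of the cube `[0,1]ⁿ` given by a Boolean vector. -/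
def cubeVertex {n : ℕ} (x : Fin n → Bool) : Fin n → ℝ := fun i => if x i = true then 1 else 0

/-- The red corner `R_v`: the union of the facets of the cube `[0,1]ⁿ` that contain `v`. -/
def redCorner {n : ℕ} (v : Fin n → Bool) : Set (Fin n → ℝ) :=
  ⋃ i : Fin n, {p | (∀ j, p j ∈ Set.Icc (0 : ℝ) 1) ∧ p i = cubeVertex v i}

/-- `R_v ∩ Σ(f)`: the subcomplex of those simplices of `Σ(f)` that are contained in `R_v` when
realized in the cube. -/
def redCornerComplex {n : ℕ} (f : (Fin n → Bool) → Bool) (v : Fin n → Bool) :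
    PreAbstractSimplicialComplex (Fin n → Bool) where
  faces := {s | s ∈ booleanComplex f ∧
    convexHull ℝ (cubeVertex '' (s : Set (Fin n → Bool))) ⊆ redCorner v}
  isRelLowerSet_faces := fun _ hs =>
    ⟨hs.1.1, fun _ hts ht =>
      ⟨((booleanComplex f).isRelLowerSet_faces hs.1).2 hts ht,
        (convexHull_mono (Set.image_mono (Finset.coe_subset.2 hts))).trans hs.2⟩⟩

/-- The total Betti number `β(f) = ∑_v b^*(Σ(f), R_v ∩ Σ(f))` in the red corner model. -/
def redCornerBetti {n : ℕ} (f : (Fin n → Bool) → Bool) : ℕ :=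
  ∑ v : Fin n → Bool, relativeBettiSum (booleanComplex f) (redCornerComplex f v)

/-- `Γ_v(f)`: the order complex of the `x ∈ f⁻¹(1)` that are neither `≤ ∼v` nor `≥ ∼v`;
equivalently `x ∧ v ≠ 0` and `x ∨ v ≠ 1`. -/
def gammaComplex {n : ℕ} (f : (Fin n → Bool) → Bool) (v : Fin n → Bool) :
    PreAbstractSimplicialComplex (Fin n → Bool) :=
  orderComplex {x | f x = true ∧ ¬ x ≤ vᶜ ∧ ¬ vᶜ ≤ x}

end

/-! Write `L = R_v ∩ Σ(f)`. Since `f ⊥ = true`, `Σ(f)` is a cone with apex `⊥`, so `H_k(Σ(f), L)` is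
the reduced homology of `L` in degree `k - 1` (`relativeBetti_eq_reducedBetti`). A simplex lies in
`R_v` iff its vertices all agree with `v` in one common coordinate. For a chain this means that no
element is `≤ vᶜ`, or that no element is `≥ vᶜ` (`exists_forall_chain_eq_iff`). So `L = A ∪ B` for
two order complexes with `A ∩ B = Γ_v(f)`.

If `v ≠ ⊥, ⊤`, then `A` is a cone with apex `⊤` and `B` a cone with apex `⊥`, and Mayer–Vietoris
(`reducedBetti_union_succ`) shifts the homology of `L` to that of `Γ_v(f)`. If `v` is `⊥` or `⊤`,
one of `A`, `B` is empty, `L` is a cone, and the term vanishes.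

No exact sequences are used. All chain groups are coordinate subspaces of `ChainSpace V m`, so
unions and intersections of complexes become `⊔` and `⊓`, and the isomorphisms are explicit maps
built from the cone operators. -/

section FiniteChains

variable {V : Type*} [PartialOrder V]

/-! ### Cones over chains -/

/-- The chain `a < x₀ < ⋯`. -/
def consChain (a : V) {m : ℕ} (σ : Fin m ↪o V) (h : ∀ i, a < σ i) : Fin (m + 1) ↪o V :=
  OrderEmbedding.ofStrictMono (Fin.cons a σ : Fin (m + 1) → V) <| by
    intro i j hij
    induction i using Fin.cases with
    | zero =>
      induction j using Fin.cases with
      | zero => exact absurd hij (lt_irrefl _)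
      | succ j => simpa using h j
    | succ i =>
      induction j using Fin.cases with
      | zero => exact absurd hij (Fin.not_lt_zero _)
      | succ j => simpa using hij

/-- The chain `x₀ < ⋯ < a`. -/
def snocChain (a : V) {m : ℕ} (σ : Fin m ↪o V) (h : ∀ i, σ i < a) : Fin (m + 1) ↪o V :=
  OrderEmbedding.ofStrictMono (Fin.snoc σ a : Fin (m + 1) → V) <| by
    intro i j hij
    induction j using Fin.lastCases with
    | last =>
      induction i using Fin.lastCases with
      | last => exact absurd hij (lt_irrefl _)
      | cast i => simpa using h i
    | cast j =>
      induction i using Fin.lastCases with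
      | last => exact absurd hij (not_lt.2 (Fin.le_last _))
      | cast i => simpa using hij

@[simp] lemma consChain_zero (a : V) {m : ℕ} (σ : Fin m ↪o V) (h : ∀ i, a < σ i) :
    consChain a σ h 0 = a := rfl

@[simp] lemma consChain_succ (a : V) {m : ℕ} (σ : Fin m ↪o V) (h : ∀ i, a < σ i) (i : Fin m) :
    consChain a σ h i.succ = σ i := rfl

@[simp] lemma snocChain_last (a : V) {m : ℕ} (σ : Fin m ↪o V) (h : ∀ i, σ i < a) :
    snocChain a σ h (Fin.last m) = a := Fin.snoc_last (α := fun _ => V) a σ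

@[simp] lemma snocChain_castSucc (a : V) {m : ℕ} (σ : Fin m ↪o V) (h : ∀ i, σ i < a)
    (i : Fin m) : snocChain a σ h i.castSucc = σ i := Fin.snoc_castSucc (α := fun _ => V) a σ i

/-- The face of a chain opposite to its `i`-th element. -/
def chainFace {m : ℕ} (i : Fin (m + 1)) (σ : Fin (m + 1) ↪o V) : Fin m ↪o V :=
  (Fin.succAboveOrderEmb i).trans σ

@[simp] lemma chainFace_apply {m : ℕ} (i : Fin (m + 1)) (σ : Fin (m + 1) ↪o V) (j : Fin m) :
    chainFace i σ j = σ (i.succAbove j) := rfl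

lemma lt_chainFace {a : V} {m : ℕ} {σ : Fin (m + 1) ↪o V} (h : ∀ i, a < σ i) (i : Fin (m + 1))
    (j : Fin m) : a < chainFace i σ j := h _

lemma chainFace_lt {a : V} {m : ℕ} {σ : Fin (m + 1) ↪o V} (h : ∀ i, σ i < a) (i : Fin (m + 1))
    (j : Fin m) : chainFace i σ j < a := h _

lemma boundaryMap_single {m : ℕ} (σ : Fin (m + 1) ↪o V) :
    boundaryMap V m (Finsupp.single σ 1) =
      ∑ i : Fin (m + 1), (-1 : ℚ) ^ (i : ℕ) • Finsupp.single (chainFace i σ) 1 := by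
  simp [boundaryMap, chainFace]

lemma chainFace_zero_consChain (a : V) {m : ℕ} (σ : Fin m ↪o V) (h : ∀ i, a < σ i) :
    chainFace 0 (consChain a σ h) = σ := by
  ext i; simp

lemma chainFace_succ_consChain (a : V) {m : ℕ} (σ : Fin (m + 1) ↪o V) (h : ∀ i, a < σ i)
    (i : Fin (m + 1)) :
    chainFace i.succ (consChain a σ h) = consChain a (chainFace i σ) (lt_chainFace h i) := by
  ext j
  induction j using Fin.cases with
  | zero => simp
  | succ j => simp

lemma chainFace_last_snocChain (a : V) {m : ℕ} (σ : Fin m ↪o V) (h : ∀ i, σ i < a) :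
    chainFace (Fin.last m) (snocChain a σ h) = σ := by
  ext i; simp

lemma chainFace_castSucc_snocChain (a : V) {m : ℕ} (σ : Fin (m + 1) ↪o V) (h : ∀ i, σ i < a)
    (i : Fin (m + 1)) :
    chainFace i.castSucc (snocChain a σ h) = snocChain a (chainFace i σ) (chainFace_lt h i) := by
  ext j
  induction j using Fin.lastCases with
  | last => simp
  | cast j => simp

open Classical in
/-- The cone with apex `a` over the chains of elements greater than `a`. -/
noncomputable def lowerCone (a : V) (m : ℕ) : ChainSpace V m →ₗ[ℚ] ChainSpace V (m + 1) :=
  Finsupp.linearCombination ℚ fun σ =>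
    if h : ∀ i, a < σ i then Finsupp.single (consChain a σ h) 1 else 0

open Classical in
/-- The cone with apex `a` over the chains of elements less than `a`. -/
noncomputable def upperCone (a : V) (m : ℕ) : ChainSpace V m →ₗ[ℚ] ChainSpace V (m + 1) :=
  Finsupp.linearCombination ℚ fun σ =>
    -- The face opposite to the last vertex enters the boundary with sign `(-1) ^ m`; this factor
    -- cancels it, so both cones satisfy the same homotopy identity.
    if h : ∀ i, σ i < a then Finsupp.single (snocChain a σ h) ((-1) ^ m) else 0

lemma lowerCone_single {a : V} {m : ℕ} {σ : Fin m ↪o V} (h : ∀ i, a < σ i) :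
    lowerCone a m (Finsupp.single σ 1) = Finsupp.single (consChain a σ h) 1 := by
  simp [lowerCone, h]

lemma lowerCone_single_of_not {a : V} {m : ℕ} {σ : Fin m ↪o V} (h : ¬ ∀ i, a < σ i) :
    lowerCone a m (Finsupp.single σ 1) = 0 := by
  simp only [lowerCone, Finsupp.linearCombination_single, dif_neg h, smul_zero]

lemma upperCone_single {a : V} {m : ℕ} {σ : Fin m ↪o V} (h : ∀ i, σ i < a) :
    upperCone a m (Finsupp.single σ 1) =
      (-1 : ℚ) ^ m • Finsupp.single (snocChain a σ h) 1 := by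
  simp [upperCone, h]

lemma upperCone_single_of_not {a : V} {m : ℕ} {σ : Fin m ↪o V} (h : ¬ ∀ i, σ i < a) :
    upperCone a m (Finsupp.single σ 1) = 0 := by
  simp only [upperCone, Finsupp.linearCombination_single, dif_neg h, smul_zero]

lemma lowerCone_lowerCone (a : V) (m : ℕ) (x : ChainSpace V m) :
    lowerCone a (m + 1) (lowerCone a m x) = 0 := by
  suffices h : lowerCone a (m + 1) ∘ₗ lowerCone a m = 0 from LinearMap.congr_fun h x
  ext1 σ
  ext1
  by_cases h : ∀ i, a < σ i
  · simp only [LinearMap.comp_apply, Finsupp.lsingle_apply, lowerCone_single h]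
    rw [lowerCone_single_of_not]
    · simp
    · exact fun h' => lt_irrefl _ (h' 0)
  · simp [LinearMap.comp_apply, lowerCone_single_of_not h]

lemma upperCone_upperCone (a : V) (m : ℕ) (x : ChainSpace V m) :
    upperCone a (m + 1) (upperCone a m x) = 0 := by
  suffices h : upperCone a (m + 1) ∘ₗ upperCone a m = 0 from LinearMap.congr_fun h x
  ext1 σ
  ext1
  by_cases h : ∀ i, σ i < a
  · simp only [LinearMap.comp_apply, Finsupp.lsingle_apply, upperCone_single h, map_smul]
    rw [upperCone_single_of_not]
    · simp
    · intro h'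
      simpa using h' (Fin.last m)
  · simp [LinearMap.comp_apply, upperCone_single_of_not h]

lemma boundaryMap_consChain_zero {a : V} {σ : Fin 0 ↪o V} (h : ∀ i, a < σ i) :
    boundaryMap V 0 (Finsupp.single (consChain a σ h) 1) = Finsupp.single σ 1 := by
  rw [boundaryMap_single]
  simp only [Fin.sum_univ_succ, chainFace_zero_consChain]
  simp

lemma boundaryMap_consChain {a : V} {m : ℕ} {σ : Fin (m + 1) ↪o V} (h : ∀ i, a < σ i) :
    boundaryMap V (m + 1) (Finsupp.single (consChain a σ h) 1) =
      Finsupp.single σ 1 - lowerCone a m (boundaryMap V m (Finsupp.single σ 1)) := by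
  rw [boundaryMap_single, boundaryMap_single, Fin.sum_univ_succ, chainFace_zero_consChain,
    map_sum, sub_eq_add_neg, ← Finset.sum_neg_distrib]
  congr 1
  · simp
  · refine Finset.sum_congr rfl fun i _ => ?_
    rw [chainFace_succ_consChain, map_smul, lowerCone_single (lt_chainFace h i), Fin.val_succ, pow_succ]
    simp

lemma boundaryMap_snocChain_zero {a : V} {σ : Fin 0 ↪o V} (h : ∀ i, σ i < a) :
    boundaryMap V 0 (Finsupp.single (snocChain a σ h) 1) = Finsupp.single σ 1 := by
  rw [boundaryMap_single, Fin.sum_univ_castSucc, chainFace_last_snocChain]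
  simp

lemma boundaryMap_snocChain {a : V} {m : ℕ} {σ : Fin (m + 1) ↪o V} (h : ∀ i, σ i < a) :
    boundaryMap V (m + 1) (Finsupp.single (snocChain a σ h) 1) =
      (-1 : ℚ) ^ (m + 1) • (Finsupp.single σ 1 -
        upperCone a m (boundaryMap V m (Finsupp.single σ 1))) := by
  rw [boundaryMap_single, boundaryMap_single, Fin.sum_univ_castSucc, chainFace_last_snocChain,
    map_sum, smul_sub, sub_eq_add_neg, Finset.smul_sum, ← Finset.sum_neg_distrib,
    add_comm (_ • _) (∑ i, _), Fin.val_last]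
  congr 1
  refine Finset.sum_congr rfl fun i _ => ?_
  rw [chainFace_castSucc_snocChain, map_smul, upperCone_single (chainFace_lt h i), smul_smul,
    smul_smul, Fin.val_castSucc, ← neg_smul]
  congr 1
  have : (-1 : ℚ) ^ m * (-1) ^ m = 1 := by rw [← mul_pow]; simp
  linear_combination (-(-1 : ℚ) ^ (i : ℕ)) * this

/-- Every nonempty chain is its least element followed by a chain. -/
lemma exists_eq_consChain {m : ℕ} (σ : Fin (m + 1) ↪o V) :
    ∃ (ρ : Fin m ↪o V) (h : ∀ i, σ 0 < ρ i), σ = consChain (σ 0) ρ h := by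
  have h (i : Fin m) : σ 0 < chainFace 0 σ i := by simp
  refine ⟨chainFace 0 σ, h, ?_⟩
  ext i
  induction i using Fin.cases with
  | zero => simp
  | succ i => simp

/-- Every nonempty chain is a chain followed by its greatest element. -/
lemma exists_eq_snocChain {m : ℕ} (σ : Fin (m + 1) ↪o V) :
    ∃ (ρ : Fin m ↪o V) (h : ∀ i, ρ i < σ (Fin.last m)), σ = snocChain (σ (Fin.last m)) ρ h := by
  have h (i : Fin m) : chainFace (Fin.last m) σ i < σ (Fin.last m) := by
    simp [Fin.castSucc_lt_last]
  refine ⟨chainFace (Fin.last m) σ, h, ?_⟩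
  ext i
  induction i using Fin.lastCases with
  | last => simp
  | cast i => simp

lemma boundaryMap_lowerCone_of_forall_lt {a : V} {m : ℕ} {x : ChainSpace V (m + 1)}
    (hx : x ∈ Finsupp.supported ℚ ℚ {σ : Fin (m + 1) ↪o V | ∀ i, a < σ i}) :
    boundaryMap V (m + 1) (lowerCone a (m + 1) x) = x - lowerCone a m (boundaryMap V m x) := by
  rw [Finsupp.supported_eq_span_single] at hx
  induction hx using Submodule.span_induction with
  | mem x hx =>
    obtain ⟨σ, hσ, rfl⟩ := hx
    rw [lowerCone_single hσ, boundaryMap_consChain]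
  | zero => simp
  | add x y _ _ hx hy => simp only [map_add, hx, hy]; abel
  | smul c x _ hx => simp only [map_smul, hx, smul_sub]

/-! ### Chains of a subset and of a complex -/

lemma map_supported_le {α β : Type*} {s : Set α} {t : Set β} (f : (α →₀ ℚ) →ₗ[ℚ] (β →₀ ℚ))
    (h : ∀ a ∈ s, f (Finsupp.single a 1) ∈ Finsupp.supported ℚ ℚ t) {x : α →₀ ℚ}
    (hx : x ∈ Finsupp.supported ℚ ℚ s) : f x ∈ Finsupp.supported ℚ ℚ t := by
  rw [Finsupp.supported_eq_span_single] at hx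
  suffices H : Submodule.span ℚ ((fun i => Finsupp.single i (1 : ℚ)) '' s) ≤
      (Finsupp.supported ℚ ℚ t).comap f from H hx
  rw [Submodule.span_le]
  rintro _ ⟨a, ha, rfl⟩
  exact h a ha

lemma single_mem_supported_one {α : Type*} {s : Set α} {a : α} (ha : a ∈ s) :
    Finsupp.single a (1 : ℚ) ∈ Finsupp.supported ℚ ℚ s :=
  Finsupp.single_mem_supported ℚ 1 ha

lemma boundaryMap_single_mem {m : ℕ} {σ : Fin (m + 1) ↪o V} {t : Set (Fin m ↪o V)}
    (h : ∀ i, chainFace i σ ∈ t) :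
    boundaryMap V m (Finsupp.single σ 1) ∈ Finsupp.supported ℚ ℚ t := by
  rw [boundaryMap_single]
  exact Submodule.sum_mem _ fun i _ => Submodule.smul_mem _ _ (single_mem_supported_one (h i))

/-- Induction by splitting off the least element `a`, instead of cancelling a double sum: from
`∂(aρ) = ρ - a∂ρ` one gets `∂∂(aρ) = ∂ρ - (∂ρ - a∂∂ρ) = a∂∂ρ = 0`. -/
lemma boundaryMap_boundaryMap (m : ℕ) (x : ChainSpace V (m + 2)) :
    boundaryMap V m (boundaryMap V (m + 1) x) = 0 := by
  suffices h : boundaryMap V m ∘ₗ boundaryMap V (m + 1) = 0 from LinearMap.congr_fun h x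
  clear x
  induction m with
  | zero =>
    ext1 σ
    ext1
    obtain ⟨ρ, h, hσ⟩ := exists_eq_consChain σ
    obtain ⟨τ, h', hρ⟩ := exists_eq_consChain ρ
    have e : boundaryMap V 0 (Finsupp.single ρ 1) = Finsupp.single τ 1 := by
      rw [hρ, boundaryMap_consChain_zero]
    have hτ : ∀ i, σ 0 < τ i := fun i => i.elim0
    simp only [LinearMap.comp_apply, Finsupp.lsingle_apply, LinearMap.zero_apply]
    rw [hσ, boundaryMap_consChain, map_sub, e, lowerCone_single hτ, boundaryMap_consChain_zero,
      sub_self]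
  | succ m ih =>
    ext1 σ
    ext1
    obtain ⟨ρ, h, hσ⟩ := exists_eq_consChain σ
    simp only [LinearMap.comp_apply, Finsupp.lsingle_apply, LinearMap.zero_apply]
    rw [hσ, boundaryMap_consChain, map_sub, boundaryMap_lowerCone_of_forall_lt]
    · have := LinearMap.congr_fun ih (Finsupp.single ρ 1)
      rw [LinearMap.comp_apply] at this
      rw [this]
      simp
    · exact boundaryMap_single_mem fun i j => h _

lemma mem_simplicialChains_boundaryMap (K : PreAbstractSimplicialComplex V) {m : ℕ}
    {x : ChainSpace V (m + 1)} (hx : x ∈ simplicialChains K (m + 1)) :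
    boundaryMap V m x ∈ simplicialChains K m := by
  refine map_supported_le _ (fun σ hσ => boundaryMap_single_mem fun i => ?_) hx
  rcases m with _ | m
  · exact Or.inl rfl
  · have hσ' := hσ.resolve_left (Nat.succ_ne_zero _)
    refine Or.inr ((K.isRelLowerSet_faces hσ').2 ?_ ?_)
    · intro y hy
      simp only [Finset.mem_map, Finset.mem_univ, true_and] at hy ⊢
      obtain ⟨j, rfl⟩ := hy
      exact ⟨_, rfl⟩
    · simp

lemma simplicialChains_orderComplex (P : Set V) (m : ℕ) :
    simplicialChains (orderComplex P) m =
      Finsupp.supported ℚ ℚ {σ : Fin m ↪o V | ∀ i, σ i ∈ P} := by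
  unfold simplicialChains
  congr 1
  ext σ
  simp only [Set.mem_ofPred_eq]
  constructor
  · rintro (rfl | h)
    · exact fun i => i.elim0
    · intro i
      exact h.2.2 _ (by simp)
  · intro h
    rcases m with _ | m
    · exact Or.inl rfl
    · refine Or.inr ⟨by simp, ?_, ?_⟩
      · simp only [Finset.coe_map, Finset.coe_univ, Set.image_univ]
        rintro _ ⟨i, rfl⟩ _ ⟨j, rfl⟩ _
        exact (le_total i j).imp (fun h => σ.monotone h) (fun h => σ.monotone h)
      · simpa using h

/-! ### Contracting homotopies -/

/-- A contracting homotopy of the augmented complex of all chains of `V`. -/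
structure IsContraction (c : (m : ℕ) → ChainSpace V m →ₗ[ℚ] ChainSpace V (m + 1)) : Prop where
  boundary_zero : ∀ x, boundaryMap V 0 (c 0 x) = x
  boundary_succ : ∀ m x, boundaryMap V (m + 1) (c (m + 1) x) = x - c m (boundaryMap V m x)

/-- The family `c` preserves the chains of the complex `K`. -/
def PreservesChains (c : (m : ℕ) → ChainSpace V m →ₗ[ℚ] ChainSpace V (m + 1))
    (K : PreAbstractSimplicialComplex V) : Prop :=
  ∀ m, ∀ x ∈ simplicialChains K m, c m x ∈ simplicialChains K (m + 1)

/-- On chains avoiding `⊥` this is the boundary formula of a cone. A chain starting at `⊥` is itself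
a cone `cρ`: `c` kills it, and `c∂(cρ) = cρ` because `c ∘ c = 0`. -/
lemma isContraction_lowerCone_bot [OrderBot V] : IsContraction (lowerCone (⊥ : V)) where
  boundary_zero x := by
    suffices h : boundaryMap V 0 ∘ₗ lowerCone (⊥ : V) 0 = LinearMap.id from LinearMap.congr_fun h x
    ext1 σ
    ext1
    simp only [LinearMap.comp_apply, Finsupp.lsingle_apply, LinearMap.id_apply]
    rw [lowerCone_single (fun i => i.elim0), boundaryMap_consChain_zero]
  boundary_succ m x := by
    suffices h : boundaryMap V (m + 1) ∘ₗ lowerCone (⊥ : V) (m + 1) =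
      LinearMap.id - lowerCone (⊥ : V) m ∘ₗ boundaryMap V m from LinearMap.congr_fun h x
    ext1 σ
    ext1
    simp only [LinearMap.comp_apply, Finsupp.lsingle_apply, LinearMap.id_apply,
      LinearMap.sub_apply]
    by_cases h : ∀ i, ⊥ < σ i
    · rw [lowerCone_single h, boundaryMap_consChain]
    · rw [lowerCone_single_of_not h, map_zero, eq_comm, sub_eq_zero]
      obtain ⟨ρ, hρ, hσ⟩ := exists_eq_consChain σ
      have h0 : σ 0 = ⊥ := by
        by_contra h0
        exact h fun i => (bot_lt_iff_ne_bot.2 h0).trans_le (σ.monotone (Fin.zero_le i))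
      simp only [h0] at hρ hσ
      rw [hσ]
      rcases m with _ | m
      · rw [boundaryMap_consChain_zero, lowerCone_single hρ]
      · rw [boundaryMap_consChain, map_sub, lowerCone_lowerCone, sub_zero, lowerCone_single hρ]

lemma isContraction_upperCone_top [OrderTop V] : IsContraction (upperCone (⊤ : V)) where
  boundary_zero x := by
    suffices h : boundaryMap V 0 ∘ₗ upperCone (⊤ : V) 0 = LinearMap.id from LinearMap.congr_fun h x
    ext1 σ
    ext1
    simp only [LinearMap.comp_apply, Finsupp.lsingle_apply, LinearMap.id_apply]
    rw [upperCone_single (fun i => i.elim0), map_smul, boundaryMap_snocChain_zero, pow_zero,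
      one_smul]
  boundary_succ m x := by
    have sq (k : ℕ) : (-1 : ℚ) ^ k * (-1) ^ k = 1 := by rw [← mul_pow]; simp
    suffices h : boundaryMap V (m + 1) ∘ₗ upperCone (⊤ : V) (m + 1) =
      LinearMap.id - upperCone (⊤ : V) m ∘ₗ boundaryMap V m from LinearMap.congr_fun h x
    ext1 σ
    ext1
    simp only [LinearMap.comp_apply, Finsupp.lsingle_apply, LinearMap.id_apply,
      LinearMap.sub_apply]
    by_cases h : ∀ i, σ i < ⊤
    · rw [upperCone_single h, map_smul, boundaryMap_snocChain, smul_smul, sq, one_smul]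
    · rw [upperCone_single_of_not h, map_zero, eq_comm, sub_eq_zero]
      obtain ⟨ρ, hρ, hσ⟩ := exists_eq_snocChain σ
      have h0 : σ (Fin.last m) = ⊤ := by
        by_contra h0
        exact h fun i => (σ.monotone (Fin.le_last i)).trans_lt (lt_top_iff_ne_top.2 h0)
      simp only [h0] at hρ hσ
      rw [hσ]
      rcases m with _ | m
      · rw [boundaryMap_snocChain_zero, upperCone_single hρ, pow_zero, one_smul]
      · rw [boundaryMap_snocChain, map_smul, map_sub, upperCone_upperCone, sub_zero,
          upperCone_single hρ, smul_smul, sq, one_smul]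

lemma preservesChains_lowerCone {P : Set V} {a : V} (ha : a ∈ P) :
    PreservesChains (lowerCone a) (orderComplex P) := by
  intro m x hx
  rw [simplicialChains_orderComplex] at hx ⊢
  refine map_supported_le _ (fun σ hσ => ?_) hx
  by_cases h : ∀ i, a < σ i
  · rw [lowerCone_single h]
    exact single_mem_supported_one (Fin.cases ha hσ)
  · rw [lowerCone_single_of_not h]
    exact Submodule.zero_mem _

lemma preservesChains_upperCone {P : Set V} {a : V} (ha : a ∈ P) :
    PreservesChains (upperCone a) (orderComplex P) := by
  intro m x hx
  rw [simplicialChains_orderComplex] at hx ⊢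
  refine map_supported_le _ (fun σ hσ => ?_) hx
  by_cases h : ∀ i, σ i < a
  · rw [upperCone_single h]
    refine Submodule.smul_mem _ _ (single_mem_supported_one fun i => ?_)
    induction i using Fin.lastCases with
    | last => simpa using ha
    | cast i => simpa using hσ i
  · rw [upperCone_single_of_not h]
    exact Submodule.zero_mem _

/-! ### Comparison of Betti numbers -/

/-- The form in which homology groups are compared: `g` lives on the ambient spaces and need not
come from a chain map. The map `Z → Z' ⧸ B'` it induces is onto, with kernel the part of `B` in `Z`.
-/
lemma finrank_subquotient_eq {M N : Type*} [AddCommGroup M] [Module ℚ M] [AddCommGroup N]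
    [Module ℚ N] (g : M →ₗ[ℚ] N) {Z B : Submodule ℚ M} {Z' B' : Submodule ℚ N}
    (hZ : ∀ x ∈ Z, g x ∈ Z') (hB : ∀ x ∈ Z, g x ∈ B' ↔ x ∈ B)
    (hs : ∀ y ∈ Z', ∃ x ∈ Z, y - g x ∈ B') :
    Module.finrank ℚ (Z ⧸ B.submoduleOf Z) = Module.finrank ℚ (Z' ⧸ B'.submoduleOf Z') := by
  let φ : Z →ₗ[ℚ] Z' ⧸ B'.submoduleOf Z' := (B'.submoduleOf Z').mkQ ∘ₗ g.restrict hZ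
  have hker : LinearMap.ker φ = B.submoduleOf Z := by
    ext x
    rw [LinearMap.mem_ker, LinearMap.comp_apply, Submodule.mkQ_apply,
      Submodule.Quotient.mk_eq_zero]
    exact hB x x.2
  have hsurj : Function.Surjective φ := by
    intro q
    obtain ⟨y, rfl⟩ := Submodule.Quotient.mk_surjective _ q
    obtain ⟨x, hx, hxy⟩ := hs y y.2
    refine ⟨⟨x, hx⟩, ?_⟩
    symm
    exact (Submodule.Quotient.eq _).2 hxy
  rw [← hker]
  exact (φ.quotKerEquivOfSurjective hsurj).finrank_eq

lemma mem_simplicialChains_of_mem_reducedCycles {K : PreAbstractSimplicialComplex V} {m : ℕ}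
    {x : ChainSpace V m} (hx : x ∈ reducedCycles K m) : x ∈ simplicialChains K m := by
  cases m with
  | zero => exact hx
  | succ m => exact hx.1

lemma boundaryMap_mem_reducedCycles {K : PreAbstractSimplicialComplex V} {m : ℕ}
    {x : ChainSpace V (m + 1)} (hx : boundaryMap V m x ∈ simplicialChains K m) :
    boundaryMap V m x ∈ reducedCycles K m := by
  cases m with
  | zero => exact hx
  | succ m => exact ⟨hx, LinearMap.mem_ker.2 (boundaryMap_boundaryMap m x)⟩

lemma IsContraction.boundary_of_mem_reducedCycles
    {c : (m : ℕ) → ChainSpace V m →ₗ[ℚ] ChainSpace V (m + 1)} (hc : IsContraction c)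
    {K : PreAbstractSimplicialComplex V} {m : ℕ} {x : ChainSpace V m}
    (hx : x ∈ reducedCycles K m) : boundaryMap V m (c m x) = x := by
  cases m with
  | zero => exact hc.boundary_zero x
  | succ m => rw [hc.boundary_succ, LinearMap.mem_ker.1 hx.2, map_zero, sub_zero]

/-- A contractible complex has no reduced homology. -/
lemma reducedBetti_eq_zero {c : (m : ℕ) → ChainSpace V m →ₗ[ℚ] ChainSpace V (m + 1)}
    (hc : IsContraction c) {K : PreAbstractSimplicialComplex V} {m : ℕ}
    (hcK : ∀ x ∈ simplicialChains K m, c m x ∈ simplicialChains K (m + 1)) :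
    reducedBetti K m = 0 := by
  have : (reducedBoundaries K m).submoduleOf (reducedCycles K m) = ⊤ := by
    rw [Submodule.submoduleOf_eq_top]
    intro x hx
    exact ⟨c m x, hcK x (mem_simplicialChains_of_mem_reducedCycles hx),
      hc.boundary_of_mem_reducedCycles hx⟩
  rw [reducedBetti, this]
  exact Module.finrank_zero_of_subsingleton

/-- The connecting isomorphism of a pair `L ⊆ K` with `K` contractible. -/
lemma relativeBetti_eq_reducedBetti
    {c : (m : ℕ) → ChainSpace V m →ₗ[ℚ] ChainSpace V (m + 1)}
    (hc : IsContraction c) {K L : PreAbstractSimplicialComplex V} (hcK : PreservesChains c K)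
    (hLK : ∀ m, simplicialChains L m ≤ simplicialChains K m) (k : ℕ) :
    relativeBetti K L k = reducedBetti L k := by
  symm
  -- Coning sends a cycle of `L` in degree `k - 1` to a relative `k`-cycle; the inverse on homology
  -- is the boundary.
  refine finrank_subquotient_eq (c k) (fun y hy => ⟨?_, ?_⟩) (fun y hy => ⟨fun h => ?_, ?_⟩)
    (fun z hz => ⟨boundaryMap V k z, boundaryMap_mem_reducedCycles hz.2, ?_⟩)
  · exact hcK _ _ (hLK _ (mem_simplicialChains_of_mem_reducedCycles hy))
  · rw [SetLike.mem_coe, Submodule.mem_comap, hc.boundary_of_mem_reducedCycles hy]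
    exact mem_simplicialChains_of_mem_reducedCycles hy
  -- Applying `∂` to `cy = ∂u + l` gives `y = ∂l`.
  · obtain ⟨_, ⟨u, hu, rfl⟩, l, hl, h⟩ := Submodule.mem_sup.1 h
    refine ⟨l, hl, ?_⟩
    rw [← hc.boundary_of_mem_reducedCycles hy, ← h, map_add, boundaryMap_boundaryMap, zero_add]
  · rintro ⟨l, hl, rfl⟩
    refine Submodule.mem_sup.2 ⟨_, ⟨-c (k + 1) l, neg_mem (hcK _ _ (hLK _ hl)), rfl⟩, l, hl, ?_⟩
    rw [map_neg, hc.boundary_succ]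
    abel
  · refine Submodule.mem_sup_left ⟨c (k + 1) z, hcK _ _ hz.1, ?_⟩
    rw [hc.boundary_succ]

/-- The Mayer–Vietoris isomorphism for a union of two contractible complexes. -/
lemma reducedBetti_union_succ
    {c c' : (m : ℕ) → ChainSpace V m →ₗ[ℚ] ChainSpace V (m + 1)}
    (hc : IsContraction c) (hc' : IsContraction c') {K K' L G : PreAbstractSimplicialComplex V}
    (hcK : PreservesChains c K) (hcK' : PreservesChains c' K')
    (hL : ∀ m, simplicialChains L m = simplicialChains K m ⊔ simplicialChains K' m)
    (hG : ∀ m, simplicialChains G m = simplicialChains K m ⊓ simplicialChains K' m) (m : ℕ) :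
    reducedBetti L (m + 1) = reducedBetti G m := by
  symm
  have hGK {x : ChainSpace V m} (hx : x ∈ reducedCycles G m) :
      x ∈ simplicialChains K m ∧ x ∈ simplicialChains K' m := by
    have := mem_simplicialChains_of_mem_reducedCycles hx
    rwa [hG] at this
  -- Suspension: the two cones over a cycle of `G`, one in `K` and one in `K'`, are glued along it.
  refine finrank_subquotient_eq (c m - c' m) (fun x hx => ⟨?_, ?_⟩)
    (fun x hx => ⟨fun h => ?_, ?_⟩) (fun y hy => ?_)
  · rw [hL]
    exact sub_mem (Submodule.mem_sup_left (hcK _ _ (hGK hx).1))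
      (Submodule.mem_sup_right (hcK' _ _ (hGK hx).2))
  · rw [SetLike.mem_coe, LinearMap.mem_ker, LinearMap.sub_apply, map_sub, hc.boundary_of_mem_reducedCycles hx,
      hc'.boundary_of_mem_reducedCycles hx, sub_self]
  -- If `cx - c'x = ∂(b + b')`, then `cx - ∂b = c'x + ∂b'` lies in both `K` and `K'`, hence in `G`,
  -- and its boundary is `x`.
  · obtain ⟨u, hu, h⟩ := h
    change u ∈ simplicialChains L (m + 2) at hu
    rw [hL] at hu
    obtain ⟨b, hb, b', hb', rfl⟩ := Submodule.mem_sup.1 hu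
    have e : c m x - boundaryMap V (m + 1) b = c' m x + boundaryMap V (m + 1) b' := by
      rw [map_add, LinearMap.sub_apply] at h
      rw [sub_eq_iff_eq_add, add_assoc, add_comm (boundaryMap _ _ b'), h]
      abel
    refine ⟨c m x - boundaryMap V (m + 1) b, ?_, ?_⟩
    · change _ ∈ simplicialChains G (m + 1)
      rw [hG]
      refine ⟨sub_mem (hcK _ _ (hGK hx).1) (mem_simplicialChains_boundaryMap K hb), ?_⟩
      rw [e]
      exact add_mem (hcK' _ _ (hGK hx).2) (mem_simplicialChains_boundaryMap K' hb')
    · rw [map_sub, boundaryMap_boundaryMap, hc.boundary_of_mem_reducedCycles hx, sub_zero]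
  · rintro ⟨g, hg, rfl⟩
    change g ∈ simplicialChains G (m + 1) at hg
    rw [hG] at hg
    refine ⟨c' (m + 1) g - c (m + 1) g, ?_, ?_⟩
    · change _ ∈ simplicialChains L (m + 2)
      rw [hL]
      exact sub_mem (Submodule.mem_sup_right (hcK' _ _ hg.2))
        (Submodule.mem_sup_left (hcK _ _ hg.1))
    · rw [map_sub, hc.boundary_succ, hc'.boundary_succ, LinearMap.sub_apply]
      abel
  -- Split the cycle as `y = b + b'`. Then `∂b = -∂b'` lies in `G`, and the suspension of `∂b`
  -- differs from `y` by `∂(cb + c'b')`.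
  · have hy1 := hy.1
    rw [hL] at hy1
    obtain ⟨b, hb, b', hb', rfl⟩ := Submodule.mem_sup.1 hy1
    have hbb : boundaryMap V m b = -boundaryMap V m b' := by
      have := LinearMap.mem_ker.1 hy.2
      rw [map_add] at this
      exact eq_neg_of_add_eq_zero_left this
    refine ⟨boundaryMap V m b, boundaryMap_mem_reducedCycles ?_,
      c (m + 1) b + c' (m + 1) b', ?_, ?_⟩
    · rw [hG]
      refine ⟨mem_simplicialChains_boundaryMap K hb, ?_⟩
      rw [hbb]
      exact neg_mem (mem_simplicialChains_boundaryMap K' hb')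
    · change _ ∈ simplicialChains L (m + 2)
      rw [hL]
      exact add_mem (Submodule.mem_sup_left (hcK _ _ hb)) (Submodule.mem_sup_right (hcK' _ _ hb'))
    · rw [map_add, hc.boundary_succ, hc'.boundary_succ, LinearMap.sub_apply, hbb, map_neg, map_neg]
      abel

/-- There is no reduced homology in degrees in which there are no simplices. -/
lemma reducedBetti_orderComplex_eq_zero {P : Set V} {m : ℕ} {s : Finset V}
    (hP : P ⊆ s) (hm : s.card < m) : reducedBetti (orderComplex P) m = 0 := by
  have hbot : simplicialChains (orderComplex P) m = ⊥ := by
    rw [simplicialChains_orderComplex]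
    have : {σ : Fin m ↪o V | ∀ i, σ i ∈ P} = ∅ := by
      ext σ
      simp only [Set.mem_ofPred_eq, Set.mem_empty_iff_false, iff_false]
      intro h
      have := Finset.card_le_card_of_injOn (s := Finset.univ) (t := s) σ (fun i _ => hP (h i))
        σ.injective.injOn
      simp at this
      omega
    rw [this, Finsupp.supported_empty]
  have : (reducedBoundaries (orderComplex P) m).submoduleOf (reducedCycles (orderComplex P) m)
      = ⊤ := by
    rw [Submodule.submoduleOf_eq_top]
    intro x hx
    have := mem_simplicialChains_of_mem_reducedCycles hx
    rw [hbot, Submodule.mem_bot] at this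
    rw [this]
    exact zero_mem _
  rw [reducedBetti, this]
  exact Module.finrank_zero_of_subsingleton

end FiniteChains

/-! ### The red corner -/

/-- `R_v` is not convex in general, so the forward direction tests the barycenter of `s`. It lies in
a single facet, and numbers in `[0,1]` whose mean is an endpoint all equal that endpoint. -/
lemma convexHull_cubeVertex_subset_redCorner_iff {n : ℕ} (v : Fin n → Bool)
    {s : Finset (Fin n → Bool)} (hs : s.Nonempty) :
    convexHull ℝ (cubeVertex '' (s : Set (Fin n → Bool))) ⊆ redCorner v ↔
      ∃ i, ∀ x ∈ s, x i = v i := by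
  constructor
  · intro h
    have hcard : (0 : ℝ) < s.card := by exact_mod_cast hs.card_pos
    have hp : ∑ x ∈ s, (s.card : ℝ)⁻¹ • cubeVertex x ∈
        convexHull ℝ (cubeVertex '' (s : Set (Fin n → Bool))) := by
      refine (convex_convexHull ℝ _).sum_mem (fun _ _ => by positivity) ?_ fun x hx =>
        subset_convexHull ℝ _ ⟨x, hx, rfl⟩
      rw [Finset.sum_const, nsmul_eq_mul, mul_inv_cancel₀ hcard.ne']
    obtain ⟨i, -, hi⟩ := Set.mem_iUnion.1 (h hp)
    refine ⟨i, ?_⟩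
    have hsum : ∑ x ∈ s, cubeVertex x i = ∑ _x ∈ s, cubeVertex v i := by
      rw [Finset.sum_apply] at hi
      simp only [Pi.smul_apply, smul_eq_mul, ← Finset.mul_sum] at hi
      rw [Finset.sum_const, nsmul_eq_mul, ← hi, mul_inv_cancel_left₀ hcard.ne']
    intro x hx
    cases hv : v i with
    | true =>
      have hle : ∀ y ∈ s, cubeVertex y i ≤ cubeVertex v i := by
        intro y _
        simp only [cubeVertex, hv, if_true]
        split_ifs <;> norm_num
      have := (Finset.sum_eq_sum_iff_of_le hle).1 hsum x hx
      simpa [cubeVertex, hv] using this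
    | false =>
      have hle : ∀ y ∈ s, cubeVertex v i ≤ cubeVertex y i := by
        intro y _
        simp only [cubeVertex, hv, Bool.false_eq_true, if_false]
        split_ifs <;> norm_num
      have := (Finset.sum_eq_sum_iff_of_le hle).1 hsum.symm x hx
      simpa [cubeVertex, hv] using this
  · rintro ⟨i, hi⟩
    refine (convexHull_min (t := {p : Fin n → ℝ | (∀ j, p j ∈ Set.Icc (0 : ℝ) 1) ∧
      p i = cubeVertex v i}) ?_ ?_).trans (Set.subset_iUnion (fun i => {p : Fin n → ℝ |
        (∀ j, p j ∈ Set.Icc (0 : ℝ) 1) ∧ p i = cubeVertex v i}) i)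
    · rintro _ ⟨x, hx, rfl⟩
      refine ⟨fun j => ?_, by simp [cubeVertex, hi x hx]⟩
      simp only [cubeVertex]
      split_ifs <;> simp
    · intro p hp q hq a b ha hb hab
      refine ⟨fun j => (convex_Icc (0 : ℝ) 1) (hp.1 j) (hq.1 j) ha hb hab, ?_⟩
      simp only [Pi.add_apply, Pi.smul_apply, smul_eq_mul, hp.2, hq.2]
      rw [← add_mul, hab, one_mul]

lemma not_le_compl_iff {n : ℕ} {x v : Fin n → Bool} :
    ¬ x ≤ vᶜ ↔ ∃ i, x i = true ∧ v i = true := by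
  simp only [Pi.le_def, not_forall, Pi.compl_apply]
  refine exists_congr fun i => ?_
  cases x i <;> cases v i <;> decide

lemma not_compl_le_iff {n : ℕ} {x v : Fin n → Bool} :
    ¬ vᶜ ≤ x ↔ ∃ i, x i = false ∧ v i = false := by
  simp only [Pi.le_def, not_forall, Pi.compl_apply]
  refine exists_congr fun i => ?_
  cases x i <;> cases v i <;> decide

/-- `x ≰ vᶜ` means that `x` and `v` share a coordinate `1`; one shared by the least element
propagates up the chain. Dually, a `0` shared by the greatest element propagates down. -/
lemma exists_forall_chain_eq_iff {n m : ℕ} (v : Fin n → Bool) (σ : Fin (m + 1) ↪o (Fin n → Bool)) :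
    (∃ i, ∀ j, σ j i = v i) ↔ (∀ j, ¬ σ j ≤ vᶜ) ∨ (∀ j, ¬ vᶜ ≤ σ j) := by
  constructor
  · rintro ⟨i, hi⟩
    cases hv : v i with
    | true => exact Or.inl fun j => not_le_compl_iff.2 ⟨i, by rw [hi, hv], hv⟩
    | false => exact Or.inr fun j => not_compl_le_iff.2 ⟨i, by rw [hi, hv], hv⟩
  · rintro (h | h)
    · obtain ⟨i, hi, hv⟩ := not_le_compl_iff.1 (h 0)
      refine ⟨i, fun j => ?_⟩
      have := σ.monotone (Fin.zero_le j) i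
      rw [hi] at this
      rw [hv]
      exact top_le_iff.1 this
    · obtain ⟨i, hi, hv⟩ := not_compl_le_iff.1 (h (Fin.last m))
      refine ⟨i, fun j => ?_⟩
      have := σ.monotone (Fin.le_last j) i
      rw [hi] at this
      rw [hv]
      exact le_bot_iff.1 this

/-! ### The complexes attached to `f` and `v`, and their homology -/

variable {n : ℕ} (f : (Fin n → Bool) → Bool) (v : Fin n → Bool)

/-- The red corner complex is the union of the order complexes of the elements not below, and of
those not above, the complement of `v`. -/
lemma simplicialChains_redCornerComplex (m : ℕ) :
    simplicialChains (redCornerComplex f v) m =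
      simplicialChains (orderComplex {x | f x = true ∧ ¬ x ≤ vᶜ}) m ⊔
        simplicialChains (orderComplex {x | f x = true ∧ ¬ vᶜ ≤ x}) m := by
  rw [simplicialChains_orderComplex, simplicialChains_orderComplex, ← Finsupp.supported_union]
  unfold simplicialChains
  congr 1
  ext σ
  simp only [Set.mem_ofPred_eq, Set.mem_union, forall_and, ← and_or_left]
  rcases m with _ | m
  · simp
  · have hface : Finset.univ.map σ.toEmbedding ∈ orderComplex {x | f x = true} ↔
        ∀ i, f (σ i) = true := by
      refine ⟨fun h i => h.2.2 _ (by simp), fun h => ⟨by simp, ?_, by simpa using h⟩⟩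
      simp only [Finset.coe_map, Finset.coe_univ, Set.image_univ]
      rintro _ ⟨i, rfl⟩ _ ⟨j, rfl⟩ _
      exact (le_total i j).imp (fun h => σ.monotone h) (fun h => σ.monotone h)
    rw [← exists_forall_chain_eq_iff, ← hface, or_iff_right (Nat.succ_ne_zero m)]
    change _ ∧ _ ↔ _
    rw [convexHull_cubeVertex_subset_redCorner_iff v (by simp)]
    simp [booleanComplex]

lemma simplicialChains_gammaComplex (m : ℕ) :
    simplicialChains (gammaComplex f v) m =
      simplicialChains (orderComplex {x | f x = true ∧ ¬ x ≤ vᶜ}) m ⊓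
        simplicialChains (orderComplex {x | f x = true ∧ ¬ vᶜ ≤ x}) m := by
  rw [gammaComplex, simplicialChains_orderComplex, simplicialChains_orderComplex,
    simplicialChains_orderComplex, ← Finsupp.supported_inter]
  congr 1
  ext σ
  simp only [Set.mem_ofPred_eq, Set.mem_inter_iff, forall_and]
  tauto

lemma relativeBetti_redCornerComplex (h0 : f ⊥ = true) (k : ℕ) :
    relativeBetti (booleanComplex f) (redCornerComplex f v) k =
      reducedBetti (redCornerComplex f v) k := by
  refine relativeBetti_eq_reducedBetti isContraction_lowerCone_bot
    (preservesChains_lowerCone (by exact h0)) (fun m => ?_) k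
  refine Finsupp.supported_mono fun σ hσ => hσ.imp_right fun h => h.1

/-- The apex `⊤` belongs to the set precisely because `⊤ ≤ vᶜ` would force `v = ⊥`. -/
lemma preservesChains_not_le_compl (h1 : f ⊤ = true) (hv : v ≠ ⊥) :
    PreservesChains (upperCone ⊤) (orderComplex {x | f x = true ∧ ¬ x ≤ vᶜ}) :=
  preservesChains_upperCone ⟨h1, fun h => hv (by simpa using h)⟩

lemma preservesChains_not_compl_le (h0 : f ⊥ = true) (hv : v ≠ ⊤) :
    PreservesChains (lowerCone ⊥) (orderComplex {x | f x = true ∧ ¬ vᶜ ≤ x}) :=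
  preservesChains_lowerCone ⟨h0, fun h => hv (by simpa using h)⟩

/-- Only the empty simplex remains, and every augmented complex contains it. This discards the empty
half of the red corner at `v = ⊥, ⊤`. -/
lemma simplicialChains_orderComplex_empty_le {V : Type*} [PartialOrder V] {P : Set V}
    (hP : P = ∅) (K : PreAbstractSimplicialComplex V) (m : ℕ) :
    simplicialChains (orderComplex P) m ≤ simplicialChains K m := by
  rw [simplicialChains_orderComplex]
  refine Finsupp.supported_mono fun σ hσ => ?_
  rcases m with _ | m
  · exact Or.inl rfl
  · have := hσ 0
    simp [hP] at this

/-- Every element is `≤ ⊥ᶜ = ⊤`, so only the half with apex `⊥` survives; `1 ≤ n` ensures `⊥ ≠ ⊤`.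
-/
lemma relativeBettiSum_bot (hn : 1 ≤ n) (h0 : f ⊥ = true) :
    relativeBettiSum (booleanComplex f) (redCornerComplex f ⊥) = 0 := by
  refine Finset.sum_eq_zero fun k _ => ?_
  rw [relativeBetti_redCornerComplex f _ h0]
  refine reducedBetti_eq_zero isContraction_lowerCone_bot ?_
  have : Nonempty (Fin n) := ⟨⟨0, hn⟩⟩
  simp only [simplicialChains_redCornerComplex]
  intro x hx
  rw [sup_eq_right.2 (simplicialChains_orderComplex_empty_le (by simp) _ _)] at hx
  exact Submodule.mem_sup_right (preservesChains_not_compl_le f ⊥ h0 bot_ne_top _ _ hx)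

lemma relativeBettiSum_top (hn : 1 ≤ n) (h0 : f ⊥ = true) (h1 : f ⊤ = true) :
    relativeBettiSum (booleanComplex f) (redCornerComplex f ⊤) = 0 := by
  refine Finset.sum_eq_zero fun k _ => ?_
  rw [relativeBetti_redCornerComplex f _ h0]
  refine reducedBetti_eq_zero isContraction_upperCone_top ?_
  have : Nonempty (Fin n) := ⟨⟨0, hn⟩⟩
  simp only [simplicialChains_redCornerComplex]
  intro x hx
  rw [sup_eq_left.2 (simplicialChains_orderComplex_empty_le (by simp) _ _)] at hx
  exact Submodule.mem_sup_left (preservesChains_not_le_compl f ⊤ h1 top_ne_bot _ _ hx)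

lemma relativeBettiSum_eq_reducedBettiSum (h0 : f ⊥ = true) (h1 : f ⊤ = true)
    (hv : v ≠ ⊥) (hv' : v ≠ ⊤) :
    relativeBettiSum (booleanComplex f) (redCornerComplex f v) =
      reducedBettiSum (gammaComplex f v) := by
  obtain ⟨N, hN⟩ : ∃ N, Fintype.card (Fin n → Bool) = N + 1 :=
    Nat.exists_eq_succ_of_ne_zero Fintype.card_ne_zero
  -- `Γ_v(f)` omits `⊥` and `⊤`, so it has at most `N - 1` vertices. This makes the two extra top
  -- terms of its Betti sum, `m = N` and `m = N + 1`, vanish.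
  have hsub : (Finset.univ \ {⊥, ⊤} : Finset (Fin n → Bool)).card < N := by
    have hne : (⊥ : Fin n → Bool) ≠ ⊤ := fun h => hv (le_bot_iff.1 (le_top.trans h.ge))
    have h2 := Finset.card_le_univ ({⊥, ⊤} : Finset (Fin n → Bool))
    rw [Finset.card_sdiff_of_subset (Finset.subset_univ _), Finset.card_univ]
    rw [Finset.card_pair hne] at h2 ⊢
    omega
  have hP : {x | f x = true ∧ ¬ x ≤ vᶜ ∧ ¬ vᶜ ≤ x} ⊆
      ((Finset.univ \ {⊥, ⊤} : Finset (Fin n → Bool)) : Set (Fin n → Bool)) := by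
    rintro x ⟨-, hx, hx'⟩
    simp only [Finset.coe_sdiff, Finset.coe_univ, Set.mem_sdiff, Set.mem_univ, true_and]
    rintro hx''
    simp only [Finset.coe_insert, Finset.coe_singleton, Set.mem_insert_iff,
      Set.mem_singleton_iff] at hx''
    rcases hx'' with rfl | rfl
    · exact hx bot_le
    · exact hx' le_top
  have hzero : ∀ m, N ≤ m → reducedBetti (gammaComplex f v) m = 0 := fun m hm =>
    reducedBetti_orderComplex_eq_zero hP (hsub.trans_le hm)
  -- Degree `-1`, not covered by the Mayer–Vietoris shift: it vanishes because the complex contains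
  -- the vertex `⊥`.
  have hred0 : reducedBetti (redCornerComplex f v) 0 = 0 := by
    refine reducedBetti_eq_zero isContraction_lowerCone_bot fun x _ => ?_
    rw [simplicialChains_redCornerComplex]
    refine Submodule.mem_sup_right (preservesChains_not_compl_le f v h0 hv' 0 x ?_)
    exact fun σ _ => Or.inl rfl
  have hsucc (m : ℕ) : reducedBetti (redCornerComplex f v) (m + 1) =
      reducedBetti (gammaComplex f v) m :=
    reducedBetti_union_succ isContraction_upperCone_top isContraction_lowerCone_bot
      (preservesChains_not_le_compl f v h1 hv) (preservesChains_not_compl_le f v h0 hv')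
      (simplicialChains_redCornerComplex f v) (simplicialChains_gammaComplex f v) m
  rw [relativeBettiSum, reducedBettiSum, hN]
  simp only [relativeBetti_redCornerComplex f v h0]
  rw [Finset.sum_range_succ', hred0, Finset.sum_range_succ, Finset.sum_range_succ,
    hzero N le_rfl, hzero (N + 1) N.le_succ]
  simp only [hsucc, add_zero]

theorem proposition3 (n : ℕ) (hn : 1 ≤ n) (f : (Fin n → Bool) → Bool)
    (h0 : f ⊥ = true) (h1 : f ⊤ = true) :
    redCornerBetti f =
      ∑ v : Fin n → Bool with v ≠ ⊥ ∧ v ≠ ⊤, reducedBettiSum (gammaComplex f v) := by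
  rw [redCornerBetti, ← Finset.sum_filter_of_ne (p := fun v => v ≠ ⊥ ∧ v ≠ ⊤)]
  · refine Finset.sum_congr rfl fun v hv => ?_
    rw [Finset.mem_filter] at hv
    exact relativeBettiSum_eq_reducedBettiSum f v h0 h1 hv.2.1 hv.2.2
  · refine fun v _ hv => ⟨?_, ?_⟩
    · rintro rfl
      exact hv (relativeBettiSum_bot f hn h0)
    · rintro rfl
      exact hv (relativeBettiSum_top f hn h0 h1)
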